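/- Let $G$ be a finite simple graph and $q\ge 0$ an integer. In the $Z_q$-forcing game on $G$ all vertices are initially white. Blue repeatedly applies one of the following rules until all vertices are blue. 1. For one token, Blue turns any one white vertex blue. 2. At no cost, if a blue vertex $v$ has exactly one white neighbor $w$, Blue may turn $w$ blue. 3. Let $B$ be the current set of blue vertices. Blue announces to White a set of at least $q+1$ vertex sets of connected components of $G[V(G)\setminus B]$; White answers with a nonempty subset $\{W_{1},\dots,W_{\ell}\}$ of the announced ones; then, at no cost, Blue may apply Rule 2 (once) on the induced subgraph $G[B\cup W_{1}\cup\dots\cup W_{\ell}]$. Let $Z_q(G)$ be the least number of tokens with which Blue can guarantee to color all of $G$ blue, whatever White does. For $n\ge 3$ and $k\ge 2$, let $C_{n,k}$ denote any graph obtained from the cycle on $n$ vertices by attaching to each vertex of the cycle at least $2$ and at most $k$ pendant vertices (the number may vary from vertex to vertex). **Theorem.** For all integers $n\ge 3$ and $k\ge 2$ and every such graph $C_{n,k}$, $$2\log_3(2)\,\log_2\!\left(\frac{n}{200}\right)\le Z_3(C_{n,k}).$$ -/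

import Mathlib

namespace ZqGame

/-- Rule 2 played on the induced subgraph `G[X]` when the blue set is `B`: some blue vertex `v` of
`G[X]` has `w` as its only white neighbour inside `X`. Rule 2 on all of `G` is the case
`X = Set.univ`. -/
def CanForce {V : Type*} (G : SimpleGraph V) (B X : Set V) (w : V) : Prop :=
  w ∈ X ∧ w ∉ B ∧ ∃ v ∈ B ∩ X, G.Adj v w ∧ ∀ u ∈ X, u ∉ B → G.Adj v u → u = w

/-- The white components: connected components of `G[V ∖ B]`, the graph induced on the white
vertices. -/
abbrev WhiteComponent {V : Type*} (G : SimpleGraph V) (B : Set V) : Type _ :=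
  (G.induce Bᶜ).ConnectedComponent

/-- The set of vertices of `G` lying in one of the white components in `S`. -/
def unionOf {V : Type*} {G : SimpleGraph V} {B : Set V} (S : Set (WhiteComponent G B)) : Set V :=
  {v | ∃ h : v ∈ Bᶜ, (G.induce Bᶜ).connectedComponentMk ⟨v, h⟩ ∈ S}

/-- `BlueWins G q t B`: in the `Z_q`-forcing game on `G`, from the position with blue set `B`, Blue
can get all vertices blue, against every play of White, spending at most `t` further tokens. -/
inductive BlueWins {V : Type*} (G : SimpleGraph V) (q : ℕ) : ℕ → Set V → Prop
  /-- All vertices are blue. -/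
  | done (t : ℕ) : BlueWins G q t Set.univ
  /-- Rule 1: for one token, Blue turns any white vertex blue. -/
  | rule1 (t : ℕ) (B : Set V) (v : V) (hv : v ∉ B) (next : BlueWins G q t (insert v B)) :
      BlueWins G q (t + 1) B
  /-- Rule 2: for free, a blue vertex with exactly one white neighbour `w` turns `w` blue. -/
  | rule2 (t : ℕ) (B : Set V) (w : V) (hw : CanForce G B Set.univ w)
      (next : BlueWins G q t (insert w B)) : BlueWins G q t B
  /-- Rule 3: Blue announces a set `C` of at least `q + 1` white components, White answers with a
  nonempty `S ⊆ C`, and Blue may then apply Rule 2 on `G[B ∪ ⋃ S]`, for free. Here `result S` is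
  the blue set that Blue chooses to reach after the answer `S`. -/
  | rule3 (t : ℕ) (B : Set V) (C : Set (WhiteComponent G B)) (hC : ((q + 1 : ℕ) : ℕ∞) ≤ C.encard)
      (result : Set (WhiteComponent G B) → Set V)
      (legal : ∀ S ⊆ C, S.Nonempty →
        result S = B ∨ ∃ w, CanForce G B (B ∪ unionOf S) w ∧ result S = insert w B)
      (next : ∀ S ⊆ C, S.Nonempty → BlueWins G q t (result S)) :
      BlueWins G q t B

/-- `Z_q(G)`: the fewest tokens with which Blue can colour all of `G` blue, starting from the
all-white colouring, whatever White does. -/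
noncomputable def Zq {V : Type*} (q : ℕ) (G : SimpleGraph V) : ℕ :=
  sInf {t | BlueWins G q t ∅}

/-- On a finite graph Blue can win by buying every vertex, so the infimum defining `Z_q(G)` is
attained. -/
theorem blueWins_Zq {V : Type*} [Finite V] (q : ℕ) (G : SimpleGraph V) :
    BlueWins G q (Zq q G) ∅ := by
  have key : ∀ (n : ℕ) (B : Set V), Bᶜ.ncard = n → BlueWins G q n B := by
    intro n
    induction n with
    | zero =>
      intro B hB
      have h : B = Set.univ := by
        rw [Set.ncard_eq_zero (Set.toFinite _)] at hB
        simpa using hB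
      subst h
      exact BlueWins.done 0
    | succ m ih =>
      intro B hB
      have hne : Bᶜ.Nonempty := by
        rw [← Set.ncard_pos (Set.toFinite _)]
        omega
      obtain ⟨v, hv⟩ := hne
      refine BlueWins.rule1 m B v hv (ih _ ?_)
      have h1 : (insert v B)ᶜ = Bᶜ \ {v} := by
        ext x
        simp only [Set.mem_compl_iff, Set.mem_insert_iff, Set.mem_sdiff, Set.mem_singleton_iff]
        tauto
      rw [h1, Set.ncard_sdiff_singleton_of_mem hv, hB]
      rfl
  exact Nat.sInf_mem (s := {t | BlueWins G q t ∅}) ⟨_, key _ ∅ rfl⟩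

/-- The caterpillar cycle: the cycle on `n` centers, with `d i` pendant vertices attached to the
center `i`. -/
def caterpillarCycle (n : ℕ) (d : Fin n → ℕ) : SimpleGraph (Fin n ⊕ (i : Fin n) × Fin (d i)) where
  Adj x y :=
    match x, y with
    | Sum.inl i, Sum.inl j => (SimpleGraph.cycleGraph n).Adj i j
    | Sum.inl i, Sum.inr p => p.1 = i
    | Sum.inr p, Sum.inl i => p.1 = i
    | Sum.inr _, Sum.inr _ => False
  symm := by
    constructor
    rintro (i | p) (j | r) h
    · exact SimpleGraph.Adj.symm h
    · exact h
    · exact h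
    · exact h
  loopless := by
    constructor
    rintro (i | p) h
    · exact (SimpleGraph.cycleGraph n).irrefl h
    · exact h

end ZqGame

/-! White protects a fully white set. If every outside neighbour of a white set lies among at most
three vertices, each with two neighbours in the set, then neither Rule 2 nor Rule 3 enters it: with
four announced components and at most three dangerous vertices, linear algebra yields an answer in
which each dangerous vertex sees no component or at least two (`exists_blocking_answer`). Only
tokens hurt such a fort, and White then retreats to a smaller one inside it
(`BlueWins.not_resilient`).

In the caterpillar cycle, arcs are forts bounded by their two ends, with room for one more boundary
vertex: a token may split an arc in two, and White gives up one half only at the next token. The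
lengths needed therefore grow like Fibonacci numbers (`resilient_arc`), so `n < fib (Z + 4)`. The
golden ratio is below `√3`, which gives the logarithmic bound. -/

namespace ZqGame

open SimpleGraph

/-! ### Forts and White's strategy -/

section Forts

variable {V : Type*} {G : SimpleGraph V} {q : ℕ}

/-- A `q`-fort: a nonempty vertex set whose outer boundary lies in a set `P` of at most `q` vertices,
each of which has at least two neighbours in the set. -/
def IsFort (G : SimpleGraph V) (q : ℕ) (R : Set V) : Prop :=
  R.Nonempty ∧ ∃ P : Finset V, P.card ≤ q ∧ (∀ r ∈ R, ∀ y ∉ R, G.Adj y r → y ∈ P) ∧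
    ∀ p ∈ P, ∃ r ∈ R, ∃ s ∈ R, r ≠ s ∧ G.Adj p r ∧ G.Adj p s

/-- Given at least `|P| + 1` white components, White can answer with some of them so that no vertex
of `P` can force. -/
theorem exists_blocking_answer {B : Set V} (P : Finset V) (hP : P.card ≤ q)
    (C : Set (WhiteComponent G B)) (hC : ((q + 1 : ℕ) : ℕ∞) ≤ C.encard) :
    ∃ S ⊆ C, S.Nonempty ∧ ∀ p ∈ P, ∀ w ∈ unionOf S, G.Adj p w →
      ∃ u ∈ unionOf S, u ≠ w ∧ G.Adj p u := by
  classical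
  obtain ⟨D, hDC, hD⟩ := Set.exists_subset_encard_eq hC
  have hfin : D.Finite := Set.finite_of_encard_eq_coe hD
  have : Fintype D := hfin.fintype
  have hcard : Fintype.card D = q + 1 := by
    have h := D.coe_fintypeCard
    rw [hD] at h
    exact_mod_cast h
  let Sees (p : V) (K : WhiteComponent G B) : Prop :=
    ∃ w, ∃ h : w ∈ Bᶜ, G.Adj p w ∧ (G.induce Bᶜ).connectedComponentMk ⟨w, h⟩ = K
  let M : Matrix P D ℚ := fun p K => if Sees p K then 1 else 0
  have hker : LinearMap.ker M.mulVecLin ≠ ⊥ := by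
    apply LinearMap.ker_ne_bot_of_finrank_lt
    simp only [Module.finrank_fintype_fun_eq_card, hcard, Fintype.card_coe]
    omega
  obtain ⟨x, hx, hx0⟩ := Submodule.exists_mem_ne_zero_of_ne_bot hker
  rw [LinearMap.mem_ker] at hx
  obtain ⟨K₀, hK₀⟩ := Function.ne_iff.mp hx0
  -- White answers with the support of a kernel vector. Each row sums to zero against it, so a
  -- vertex of `P` that sees one component of the support sees a second.
  refine ⟨{K | ∃ h : K ∈ D, x ⟨K, h⟩ ≠ 0}, fun K hK => hDC hK.1, ⟨K₀, K₀.2, hK₀⟩, ?_⟩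
  rintro p hp w ⟨hwB, hwD, hxw⟩ hpw
  set K : D := ⟨_, hwD⟩ with hK
  have hsum : ∑ L : D, M ⟨p, hp⟩ L * x L = 0 := congrFun hx ⟨p, hp⟩
  have hMK : M ⟨p, hp⟩ K = 1 := if_pos ⟨w, hwB, hpw, rfl⟩
  have hL : ∃ L : D, L ≠ K ∧ M ⟨p, hp⟩ L * x L ≠ 0 := by
    by_contra! h
    rw [Finset.sum_eq_single K (fun L _ hL => h L hL) (by simp), hMK, one_mul] at hsum
    exact hxw hsum
  obtain ⟨L, hLK, hML⟩ := hL
  have hsees : Sees p L := by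
    by_contra h
    exact hML (by simp [M, h])
  obtain ⟨u, huB, hpu, huL⟩ := hsees
  refine ⟨u, ⟨huB, ?_⟩, ?_, hpu⟩
  · rw [huL]
    exact ⟨L.2, right_ne_zero_of_mul hML⟩
  · rintro rfl
    exact hLK (Subtype.ext huL.symm)

/-- `Resilient G q t R`: from the `q`-fort `R`, White keeps some vertex of `R` white although Blue
spends `t` tokens. -/
def Resilient (G : SimpleGraph V) (q : ℕ) : ℕ → Set V → Prop
  | 0, R => IsFort G q R
  | t + 1, R => IsFort G q R ∧ ∀ x ∈ R, ∃ R' ⊆ R, x ∉ R' ∧ Resilient G q t R'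

theorem Resilient.isFort {t : ℕ} {R : Set V} (h : Resilient G q t R) : IsFort G q R := by
  cases t with
  | zero => exact h
  | succ t => exact h.1

theorem Resilient.of_succ {t : ℕ} {R : Set V} (h : Resilient G q (t + 1) R) :
    Resilient G q t R := by
  induction t generalizing R with
  | zero => exact h.1
  | succ t ih =>
    refine ⟨h.1, fun x hx => ?_⟩
    obtain ⟨R', h1, h2, h3⟩ := h.2 x hx
    exact ⟨R', h1, h2, ih h3⟩

/-- As long as the fort is white, a force into it must come from a boundary vertex, which has two
white neighbours there (Rule 2) or is blocked by White's answer (Rule 3). A token inside the fort is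
met by passing to a smaller fort that avoids it. -/
theorem BlueWins.not_resilient {t : ℕ} {B : Set V} (h : BlueWins G q t B) {R : Set V}
    (hRB : Disjoint R B) : ¬ Resilient G q t R := by
  induction h generalizing R with
  | done t =>
    intro hR
    obtain ⟨r, hr⟩ := hR.isFort.1
    exact Set.disjoint_left.mp hRB hr (Set.mem_univ r)
  | rule1 t B v hv next ih =>
    intro hR
    by_cases hvR : v ∈ R
    · obtain ⟨R', h1, h2, h3⟩ := hR.2 v hvR
      exact ih (Set.disjoint_insert_right.mpr ⟨h2, hRB.mono_left h1⟩) h3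
    · exact ih (Set.disjoint_insert_right.mpr ⟨hvR, hRB⟩) hR.of_succ
  | rule2 t B w hw next ih =>
    intro hR
    refine ih (Set.disjoint_insert_right.mpr ⟨fun hwR => ?_, hRB⟩) hR
    obtain ⟨-, P, -, hbd, hP⟩ := hR.isFort
    obtain ⟨-, -, v, hv, hvw, huniq⟩ := hw
    have hvR : v ∉ R := fun hvR => Set.disjoint_left.mp hRB hvR hv.1
    obtain ⟨r, hr, s, hs, hrs, hvr, hvs⟩ := hP v (hbd w hwR v hvR hvw)
    exact hrs ((huniq r trivial (Set.disjoint_left.mp hRB hr) hvr).trans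
      (huniq s trivial (Set.disjoint_left.mp hRB hs) hvs).symm)
  | rule3 t B C hC result legal next ih =>
    intro hR
    obtain ⟨-, P, hcard, hbd, -⟩ := hR.isFort
    obtain ⟨S, hSC, hS, hblock⟩ := exists_blocking_answer P hcard C hC
    refine ih S hSC hS ?_ hR
    rcases legal S hSC hS with h | ⟨w, ⟨hwX, hwB, v, hv, hvw, huniq⟩, h⟩
    · rwa [h]
    · rw [h]
      refine Set.disjoint_insert_right.mpr ⟨fun hwR => ?_, hRB⟩
      have hvR : v ∉ R := fun hvR => Set.disjoint_left.mp hRB hvR hv.1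
      obtain ⟨u, hu, huw, hvu⟩ :=
        hblock v (hbd w hwR v hvR hvw) w (hwX.resolve_left hwB) hvw
      exact huw (huniq u (Or.inr hu) hu.1 hvu)

theorem Resilient.lt_Zq [Finite V] {t : ℕ} {R : Set V} (h : Resilient G q t R) :
    t < Zq q G := by
  by_contra! hle
  have hmono : ∀ s, Resilient G q (Zq q G + s) R → Resilient G q (Zq q G) R := by
    intro s
    induction s with
    | zero => exact id
    | succ s ih => exact fun hs => ih hs.of_succ
  exact (blueWins_Zq q G).not_resilient (Set.disjoint_empty R)
    (hmono (t - Zq q G) (by rwa [Nat.add_sub_cancel' hle]))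

end Forts

/-! ### Arcs of the caterpillar cycle -/

section Arcs

variable {n : ℕ} {d : Fin n → ℕ}

/-- The centers strictly between `a` and `b` together with the pendant vertices attached to the
centers from `a` to `b`, leaving out everything at the position `v`. -/
def arc (d : Fin n → ℕ) (a v b : ℕ) : Set (Fin n ⊕ (i : Fin n) × Fin (d i))
  | Sum.inl i => a < i.val ∧ i.val < b ∧ i.val ≠ v
  | Sum.inr p => a ≤ p.1.val ∧ p.1.val ≤ b ∧ p.1.val ≠ v

/-- The position on the cycle of a vertex of the caterpillar cycle. -/
def position : Fin n ⊕ (i : Fin n) × Fin (d i) → ℕ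
  | Sum.inl i => i.val
  | Sum.inr p => p.1.val

theorem position_of_mem_arc {a v b : ℕ} {x : Fin n ⊕ (i : Fin n) × Fin (d i)}
    (hx : x ∈ arc d a v b) : a ≤ position x ∧ position x ≤ b ∧ position x ≠ v := by
  rcases x with i | p
  · exact ⟨hx.1.le, hx.2.1.le, hx.2.2⟩
  · exact hx

theorem position_lt (x : Fin n ⊕ (i : Fin n) × Fin (d i)) : position x < n := by
  rcases x with i | p
  · exact i.isLt
  · exact p.1.isLt

theorem arc_subset_arc {a v b a' v' b' : ℕ} (ha : a ≤ a') (hb : b' ≤ b)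
    (hv : v < a' ∨ b' < v ∨ v = v') : arc d a' v' b' ⊆ arc d a v b := by
  rintro (i | p) ⟨h1, h2, h3⟩
  · refine ⟨?_, ?_, ?_⟩ <;> omega
  · refine ⟨?_, ?_, ?_⟩ <;> omega

theorem cycleGraph_adj_of_val_succ {i j : Fin n} (h : j.val = i.val + 1) :
    (cycleGraph n).Adj i j := by
  have := i.isLt
  have := j.isLt
  rw [cycleGraph_adj']
  right
  rw [Fin.sub_def]
  simp only
  rw [show n - i.val + j.val = 1 + n by omega, Nat.add_mod_right, Nat.mod_eq_of_lt (by omega)]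

theorem val_of_cycleGraph_adj {i j : Fin n} (h : (cycleGraph n).Adj i j) (hj0 : 0 < j.val)
    (hjn : j.val + 1 < n) : i.val = j.val + 1 ∨ j.val = i.val + 1 := by
  have hi := i.isLt
  rw [cycleGraph_adj'] at h
  simp only [Fin.sub_def] at h
  rcases h with h | h
  · left
    rcases lt_or_ge (n - j.val + i.val) n with h' | h'
    · rw [Nat.mod_eq_of_lt h'] at h
      omega
    · rw [Nat.mod_eq_sub_mod h', Nat.mod_eq_of_lt (by omega)] at h
      omega
  · right
    rcases lt_or_ge (n - i.val + j.val) n with h' | h'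
    · rw [Nat.mod_eq_of_lt h'] at h
      omega
    · rw [Nat.mod_eq_sub_mod h', Nat.mod_eq_of_lt (by omega)] at h
      omega

/-- The boundary consists of the centers at `a`, `b` and, if it exists, `v`. An end sees its own
pendant vertex and the adjacent inner center; `v` sees the centers on both sides. -/
theorem isFort_arc (hd : ∀ i, 1 ≤ d i) {a v b : ℕ} (hbn : b < n) (hab : a + 1 < b)
    (hv : n ≤ v ∨ a + 1 < v ∧ v + 1 < b) :
    IsFort (caterpillarCycle n d) 3 (arc d a v b) := by
  classical
  refine ⟨⟨Sum.inl ⟨a + 1, by omega⟩, ?_⟩,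
    (Finset.univ.filter fun i : Fin n => i.val ∈ ({a, v, b} : Finset ℕ)).map
      Function.Embedding.inl, ?_, ?_, ?_⟩
  · refine ⟨?_, ?_, ?_⟩ <;> simp only <;> omega
  · rw [Finset.card_map]
    refine le_trans (Finset.card_le_card_of_injOn (fun i : Fin n => i.val) ?_
      (Fin.val_injective.injOn)) (Finset.card_le_three (a := a) (b := v) (c := b))
    intro i hi
    simpa using hi
  · intro r hr y hy hyr
    simp only [Finset.mem_map, Finset.mem_filter, Finset.mem_univ, true_and,
      Finset.mem_insert, Finset.mem_singleton, Function.Embedding.inl_apply]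
    rcases r with j | p
    · obtain ⟨h1, h2, h3⟩ := hr
      rcases y with i | p
      · have hij := val_of_cycleGraph_adj (show (cycleGraph n).Adj i j from hyr)
          (by omega) (by omega)
        refine ⟨i, ?_, rfl⟩
        by_contra hne
        exact hy ⟨by omega, by omega, by omega⟩
      · have hp : p.1 = j := hyr
        exact absurd (show _ ∧ _ ∧ _ from by rw [hp]; exact ⟨h1.le, h2.le, h3⟩) hy
    · obtain ⟨h1, h2, h3⟩ := hr
      rcases y with i | p'
      · have hp : p.1 = i := hyr
        rw [hp] at h1 h2 h3
        refine ⟨i, ?_, rfl⟩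
        by_contra hne
        exact hy ⟨by omega, by omega, by omega⟩
      · exact (show False from hyr).elim
  · intro p hp
    simp only [Finset.mem_map, Finset.mem_filter, Finset.mem_univ, true_and,
      Finset.mem_insert, Finset.mem_singleton, Function.Embedding.inl_apply] at hp
    obtain ⟨i, hi, rfl⟩ := hp
    have hin := i.isLt
    have hmem : ∀ j : Fin n, a < j.val → j.val < b → j.val ≠ v →
        (Sum.inl j : Fin n ⊕ (i : Fin n) × Fin (d i)) ∈ arc d a v b :=
      fun j h1 h2 h3 => ⟨h1, h2, h3⟩
    have hleaf : ∀ j : Fin n, a ≤ j.val → j.val ≤ b → j.val ≠ v →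
        (Sum.inr ⟨j, ⟨0, hd j⟩⟩ : Fin n ⊕ (i : Fin n) × Fin (d i)) ∈ arc d a v b :=
      fun j h1 h2 h3 => ⟨h1, h2, h3⟩
    have hup : ∀ j : Fin n, j.val = i.val + 1 →
        (caterpillarCycle n d).Adj (Sum.inl i) (Sum.inl j) :=
      fun j hj => cycleGraph_adj_of_val_succ hj
    have hdown : ∀ j : Fin n, i.val = j.val + 1 →
        (caterpillarCycle n d).Adj (Sum.inl i) (Sum.inl j) :=
      fun j hj => (cycleGraph_adj_of_val_succ hj).symm
    rcases hi with hi | hi | hi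
    · exact ⟨_, hmem ⟨i.val + 1, by omega⟩ (by simp only; omega) (by simp only; omega)
        (by simp only; omega), _, hleaf i (by omega) (by omega) (by omega), Sum.inl_ne_inr,
        hup _ rfl, rfl⟩
    · refine ⟨_, hmem ⟨i.val + 1, by omega⟩ (by simp only; omega) (by simp only; omega)
        (by simp only; omega), _, hmem ⟨i.val - 1, by omega⟩ (by simp only; omega)
        (by simp only; omega) (by simp only; omega), ?_, hup _ rfl, hdown _ (by simp only; omega)⟩
      intro h
      have := congrArg Fin.val (Sum.inl_injective h)
      simp only at this
      omega
    · exact ⟨_, hmem ⟨i.val - 1, by omega⟩ (by simp only; omega) (by simp only; omega)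
        (by simp only; omega), _, hleaf i (by omega) (by omega) (by omega), Sum.inl_ne_inr,
        hdown _ (by simp only; omega), rfl⟩

/-- The position `n` does not occur on the cycle, so `arc d a n b` is an unsplit arc. Unsplit arcs,
and arcs split at one center, survive a number of tokens governed by the Fibonacci numbers. -/
theorem resilient_arc (hd : ∀ i, 1 ≤ d i) (t : ℕ) :
    (∀ a b, b < n → a + Nat.fib (t + 4) ≤ b + 1 →
      Resilient (caterpillarCycle n d) 3 t (arc d a n b)) ∧
    ∀ a v b, b < n → a + 1 < v → v + 1 < b → a + Nat.fib (t + 5) ≤ b + 1 →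
      Resilient (caterpillarCycle n d) 3 t (arc d a v b) := by
  induction t with
  | zero =>
    -- The shortest unsplit arc has two ends and one inner center; the shortest split one has `v`
    -- and a center on each side of it.
    have h4 : Nat.fib 4 = 3 := rfl
    have h5 : Nat.fib 5 = 5 := rfl
    simp only [zero_add, h4, h5]
    exact ⟨fun a b hbn hab => isFort_arc hd hbn (by omega) (Or.inl le_rfl),
      fun a v b hbn hav hvb _ => isFort_arc hd hbn (by omega) (Or.inr ⟨hav, hvb⟩)⟩
  | succ t ih =>
    obtain ⟨ih1, ih2⟩ := ih
    have h5 : Nat.fib (t + 5) = Nat.fib (t + 3) + Nat.fib (t + 4) := Nat.fib_add_two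
    have h6 : Nat.fib (t + 6) = Nat.fib (t + 4) + Nat.fib (t + 5) := Nat.fib_add_two
    have h3 : 2 ≤ Nat.fib (t + 3) := Nat.fib_mono (show 3 ≤ t + 3 by omega)
    have h4 : 3 ≤ Nat.fib (t + 4) := Nat.fib_mono (show 4 ≤ t + 4 by omega)
    have hone : ∀ a b, b < n → a + Nat.fib (t + 5) ≤ b + 1 →
        Resilient (caterpillarCycle n d) 3 (t + 1) (arc d a n b) := by
      intro a b hbn hab
      refine ⟨isFort_arc hd hbn (by omega) (Or.inl le_rfl), fun x hx => ?_⟩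
      obtain ⟨hax, hxb, -⟩ := position_of_mem_arc hx
      have hxn := position_lt x
      -- A token near an end costs two positions, covered by `fib (t + 3) ≥ 2`. Any other token
      -- becomes the splitting position.
      rcases le_or_gt (position x) (a + 1) with h | h
      · refine ⟨arc d (a + 2) n b, arc_subset_arc (by omega) le_rfl (Or.inr (Or.inr rfl)),
          fun hx' => ?_, ih1 _ _ hbn (by omega)⟩
        have := position_of_mem_arc hx'
        omega
      rcases le_or_gt b (position x + 1) with h' | h'
      · refine ⟨arc d a n (b - 2), arc_subset_arc le_rfl (by omega) (Or.inr (Or.inr rfl)),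
          fun hx' => ?_, ih1 _ _ (by omega) (by omega)⟩
        have := position_of_mem_arc hx'
        omega
      · exact ⟨arc d a (position x) b,
          arc_subset_arc le_rfl le_rfl (Or.inr (Or.inl hbn)),
          fun hx' => (position_of_mem_arc hx').2.2 rfl, ih2 _ _ _ hbn h h' hab⟩
    refine ⟨hone, fun a v b hbn hav hvb (hab : a + Nat.fib (t + 6) ≤ b + 1) => ?_⟩
    refine ⟨isFort_arc hd hbn (by omega) (Or.inr ⟨hav, hvb⟩), fun x hx => ?_⟩
    have hleft : arc d a n (v - 1) ⊆ arc d a v b :=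
      arc_subset_arc le_rfl (by omega) (by omega)
    have hright : arc d (v + 1) n b ⊆ arc d a v b :=
      arc_subset_arc (by omega) le_rfl (by omega)
    -- White keeps the half without the token if it has length at least `fib (t + 4)`. Otherwise the
    -- half on the token's side has length at least `fib (t + 5)`, and `hone` lets it absorb this
    -- token as an unsplit arc.
    rcases lt_or_ge (position x) v with h | h
    · by_cases hlen : v + 1 + Nat.fib (t + 4) ≤ b + 1
      · refine ⟨_, hright, fun hx' => ?_, ih1 _ _ hbn hlen⟩
        have := position_of_mem_arc hx'
        omega
      · have hres := hone a (v - 1) (by omega) (by omega)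
        by_cases hx' : x ∈ arc d a n (v - 1)
        · obtain ⟨R', h1, h2, h3⟩ := hres.2 x hx'
          exact ⟨R', h1.trans hleft, h2, h3⟩
        · exact ⟨_, hleft, hx', hres.of_succ⟩
    · by_cases hlen : a + Nat.fib (t + 4) ≤ v - 1 + 1
      · refine ⟨_, hleft, fun hx' => ?_, ih1 _ _ (by omega) hlen⟩
        have := position_of_mem_arc hx'
        omega
      · have hres := hone (v + 1) b (by omega) (by omega)
        by_cases hx' : x ∈ arc d (v + 1) n b
        · obtain ⟨R', h1, h2, h3⟩ := hres.2 x hx'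
          exact ⟨R', h1.trans hright, h2, h3⟩
        · exact ⟨_, hright, hx', hres.of_succ⟩

theorem lt_fib_Zq_caterpillarCycle (hd : ∀ i, 1 ≤ d i) :
    n < Nat.fib (Zq 3 (caterpillarCycle n d) + 4) := by
  by_contra! h
  have h3 : 3 ≤ Nat.fib (Zq 3 (caterpillarCycle n d) + 4) :=
    Nat.fib_mono (show 4 ≤ Zq 3 (caterpillarCycle n d) + 4 by omega)
  -- The cycle is cut between positions `n - 1` and `0`; both end centers lie outside the fort, so
  -- the edge joining them does no harm.
  exact ((resilient_arc hd _).1 0 (n - 1) (by omega) (by omega)).lt_Zq.false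

end Arcs

theorem fib_add_four_le (t : ℕ) : (Nat.fib (t + 4) : ℝ) ≤ 5 * √3 ^ t := by
  have hs : √3 ^ 2 = (3 : ℝ) := Real.sq_sqrt (by norm_num)
  have h1 : (1 : ℝ) ≤ √3 := Real.one_le_sqrt.mpr (by norm_num)
  have h2 : √3 ≤ (2 : ℝ) := by nlinarith
  induction t using Nat.twoStepInduction with
  | zero => norm_num [Nat.fib]
  | one =>
    have h5 : Nat.fib (1 + 4) = 5 := rfl
    rw [h5, pow_one]
    push_cast
    linarith
  | more t ih1 ih2 =>
    have h : Nat.fib (t + 2 + 4) = Nat.fib (t + 4) + Nat.fib (t + 1 + 4) := Nat.fib_add_two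
    rw [h]
    push_cast
    have hpos : (0 : ℝ) < √3 ^ t := by positivity
    rw [pow_succ] at ih2
    rw [pow_add, hs]
    -- The step reduces to `1 + √3 ≤ 3`.
    nlinarith

end ZqGame

theorem theorem4p14 (n k : ℕ) (hn : 3 ≤ n) (hk : 2 ≤ k) (d : Fin n → ℕ)
    (hd : ∀ i, 2 ≤ d i ∧ d i ≤ k) :
    2 * Real.logb 3 2 * Real.logb 2 ((n : ℝ) / 200) ≤
      (ZqGame.Zq 3 (ZqGame.caterpillarCycle n d) : ℝ) := by
  have hlt := ZqGame.lt_fib_Zq_caterpillarCycle (d := d) fun i => one_le_two.trans (hd i).1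
  set Z := ZqGame.Zq 3 (ZqGame.caterpillarCycle n d)
  have hn0 : (0 : ℝ) < n := by
    have : 0 < n := by omega
    exact_mod_cast this
  have hlt' : (n : ℝ) < Nat.fib (Z + 4) := by exact_mod_cast hlt
  have hle : (n : ℝ) / 200 ≤ √3 ^ Z := by
    have := ZqGame.fib_add_four_le Z
    have : (0 : ℝ) < √3 ^ Z := by positivity
    linarith
  rw [mul_assoc, Real.mul_logb (by norm_num) (by norm_num) (by norm_num)]
  have hlog : Real.logb 3 ((n : ℝ) / 200) ≤ Real.logb 3 (√3 ^ Z) :=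
    Real.logb_le_logb_of_le (by norm_num) (by positivity) hle
  have hs : Real.logb 3 (√3 ^ Z) = Z * (1 / 2) := by
    rw [Real.logb_pow, Real.sqrt_eq_rpow, Real.logb_rpow (by norm_num) (by norm_num)]
  linarith
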